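/- Let $(P_t)_{t\in\mathbb R}$ be probability measures on a measurable space $(\Omega,\mathcal A)$, let $\vartheta_0\in\mathbb R$, and put $P_{n,\vartheta}:=P_{\vartheta_0+\vartheta/\sqrt n}^{\otimes n}$ on $(\Omega^n,\mathcal A^n)$ for $\vartheta\in\mathbb R$, $n\ge 1$. Let $\Theta\subset\mathbb R$ with $0\in\Theta$ be such that the closure of $\Theta$ has nonempty interior. Assume local asymptotic normality (LAN) for $\Theta$: there are $\sigma>0$ and random variables $X_n:\Omega^n\to\mathbb R$ such that $$\log\frac{dP_{n,\vartheta}}{dP_{n,0}}-\Big[\vartheta X_n-\frac{\vartheta^2\sigma^2}{2}\Big]\to 0\quad\text{in }P_{n,0}\text{-probability for every }\vartheta\in\Theta,$$ and $\mathcal L(X_n\mid P_{n,0})\to N(0,\sigma^2)$ weakly (here $dP_{n,\vartheta}/dP_{n,0}$ is the density of the absolutely continuous part, and $\log 0=-\infty$). Let $T_n:\Omega^n\to\mathbb R$ be a sequence of $\Theta$-regular estimators, i.e. there is a probability measure $Q$ on $\mathbb R$, not depending on $\vartheta$, such that $\mathcal L\big(\sqrt n(T_n-(\vartheta_0+\vartheta/\sqrt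 n))\mid P_{n,\vartheta}\big)\to Q$ weakly for every $\vartheta\in\Theta$; equivalently, $\mathcal L(\sqrt n(T_n-\vartheta_0)\mid P_{n,\vartheta})\to Q*\varepsilon_\vartheta$ for every $\vartheta\in\Theta$, where $\varepsilon_\vartheta$ is the point mass at $\vartheta$. Then: (a) For each $\vartheta\in\Theta$ the random vectors $\big(X_n,\ \sqrt n(T_n-\vartheta_0)-X_n/\sigma^2\big)$ converge in distribution under $P_{n,\vartheta}$ to a pair $(X,Z)$ of independent random variables. The weak limit $\nu$ of $\mathcal L(\sqrt n(T_n-\vartheta_0)-X_n/\sigma^2\mid P_{n,0})$ exists, and $\mathcal L(\sqrt n(T_n-\vartheta_0)-X_n/\sigma^2\mid P_{n,\vartheta})\to\nu$ with the same $\nu$ for every $\vartheta\in\Theta$. (b) For each $\vartheta\in\Theta$ the limit distribution of the random vectors in (a) under $P_{n,\vartheta}$ is $N(\vartheta\sigma^2,\sigma^2)\otimes\nu$, and $$Q*\varepsilon_\vartheta=\nu*N\big(\vartheta,\tfrac1{\sigma^2}\big).$$ (c) The sequence $T_n$ is asymptotically efficient at $\vartheta_0$, i.e. $\sqrt n(T_n-\vartheta_0)-X_n/\sigma^2\to0$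 in $P_{n,0}$-probability, if and only if the weak limit $Q*\varepsilon_\vartheta$ of $\sqrt n(T_n-\vartheta_0)$ with respect to $P_{n,\vartheta}$ equals $N(\vartheta,\frac1{\sigma^2})$ for at least one $\vartheta\in\Theta$. -/

import Mathlib

open MeasureTheory ProbabilityTheory Filter
open scoped ENNReal Topology

noncomputable section

namespace LANModel

variable {Ω : Type*} [MeasurableSpace Ω]

/-- The local model `P_{n,θ} = (P_{θ₀ + θ/√n})^{⊗ n}`: the law of `n` independent observations
under the parameter `θ₀ + θ/√n`. -/
abbrev localModel (P : ℝ → Measure Ω) (θ₀ : ℝ) (n : ℕ) (θ : ℝ) : Measure (Fin n → Ω) :=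
  Measure.pi fun _ : Fin n => P (θ₀ + θ / √(n : ℝ))

/-- Convergence to zero in probability of extended real valued functions `Y n` which may live on
different probability spaces: `μ n (|Y n| ≥ ε) → 0` for every `ε > 0`. -/
def TendstoZeroInProb {S : ℕ → Type*} [∀ n, MeasurableSpace (S n)] (μ : (n : ℕ) → Measure (S n))
    (Y : (n : ℕ) → S n → EReal) : Prop :=
  ∀ ε : ℝ, 0 < ε →
    Tendsto (fun n => μ n {ω | ENNReal.ofReal ε ≤ (Y n ω).abs}) atTop (𝓝 0)

/-- The log-likelihood ratio `log (dP_{n,θ} / dP_{n,0})`. The density is the one of the absolutely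
continuous part of `P_{n,θ}` with respect to `P_{n,0}`, and the logarithm takes its values in
`[-∞, ∞]`, with `log 0 = -∞`. -/
def logLR (P : ℝ → Measure Ω) (θ₀ : ℝ) (n : ℕ) (θ : ℝ) (ω : Fin n → Ω) : EReal :=
  ENNReal.log ((localModel P θ₀ n θ).rnDeriv (localModel P θ₀ n 0) ω)

/-- Local asymptotic normality at `θ₀` for the local parameter set `Θ`, with constant `σ > 0` and
central sequence `X n`. -/
structure IsLAN (P : ℝ → Measure Ω) [∀ t, IsProbabilityMeasure (P t)] (θ₀ : ℝ) (Θ : Set ℝ)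
    (σ : ℝ) (X : (n : ℕ) → (Fin n → Ω) → ℝ) : Prop where
  zero_mem : (0 : ℝ) ∈ Θ
  sigma_pos : 0 < σ
  measurable : ∀ n, Measurable (X n)
  expansion : ∀ θ ∈ Θ, TendstoZeroInProb (fun n => localModel P θ₀ n 0)
    (fun n ω => logLR P θ₀ n θ ω - ((θ * X n ω - θ ^ 2 * σ ^ 2 / 2 : ℝ) : EReal))
  clt : TendstoInDistribution X atTop id (fun n => localModel P θ₀ n 0)
    (gaussianReal 0 (σ ^ 2).toNNReal)

/-- `Θ`-regularity of a sequence of estimators `T n`: under `P_{n,θ}` the law of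
`√n (T n - (θ₀ + θ/√n))` converges weakly to `Q`, which does not depend on `θ ∈ Θ`. -/
structure IsRegular (P : ℝ → Measure Ω) [∀ t, IsProbabilityMeasure (P t)] (θ₀ : ℝ) (Θ : Set ℝ)
    (T : (n : ℕ) → (Fin n → Ω) → ℝ) (Q : Measure ℝ) [IsProbabilityMeasure Q] : Prop where
  measurable : ∀ n, Measurable (T n)
  tendsto : ∀ θ ∈ Θ, TendstoInDistribution
    (fun (n : ℕ) ω => √(n : ℝ) * (T n ω - (θ₀ + θ / √(n : ℝ)))) atTop id
    (fun n => localModel P θ₀ n θ) Q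

/-- The remainder `√n (T n - θ₀) - X n / σ²` of the linearization of `T n`. -/
def remainder (θ₀ σ : ℝ) (X T : (n : ℕ) → (Fin n → Ω) → ℝ) (n : ℕ) (ω : Fin n → Ω) : ℝ :=
  √(n : ℝ) * (T n ω - θ₀) - X n ω / σ ^ 2

/-- Asymptotic efficiency at `θ₀`: the remainder of the linearization tends to zero in
`P_{n,0}`-probability. -/
def IsAsympEfficient (P : ℝ → Measure Ω) (θ₀ σ : ℝ) (X T : (n : ℕ) → (Fin n → Ω) → ℝ) : Prop :=
  TendstoZeroInProb (fun n => localModel P θ₀ n 0)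
    (fun n ω => ((remainder θ₀ σ X T n ω : ℝ) : EReal))

end LANModel

end

/-!
# The convolution theorem for regular estimators under local asymptotic normality

Write `S n = √n (T n - θ₀)`. Under `P_{n,0}` both `X n` and `S n` converge in law, so their joint
laws are tight and, by Prokhorov's theorem, have limit points `m`. Le Cam's third lemma
(`tendstoInDistribution_of_log_rnDeriv`) identifies the corresponding limit under `P_{n,θ}` as the
tilted measure `exp (θ x - θ² σ² / 2) m(dx, ds)`, whose second marginal must be `Q ∗ ε_θ` by
regularity. In terms of the characteristic function `φ` of `Q` this reads

  `∫ exp (i t s + z x) m(dx, ds) = exp (z² σ² / 2 + i t z) φ(t)`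

for `z = θ ∈ Θ`. Both sides are entire functions of `z`, because the first marginal of `m` is
Gaussian, and `Θ` has accumulation points; hence the identity holds for all complex `z`
(`integral_cexp_of_regular`). At imaginary `z` it gives the characteristic function of `m`.

Consequently `m` is unique and the joint laws converge (`exists_tendstoInDistribution_prodMk`).
Reading off the characteristic function of `(x, s - x / σ²)` shows that the residual
`s - x / σ²` is independent of `x` (`map_residual_eq_prod`) and that its law `ν` has characteristic
function `exp (t² / (2 σ²)) φ(t)`, which is the convolution formula
(`conv_dirac_eq_conv_gaussianReal`). Tilting `N(0, σ²) ⊗ ν` by a function of the first coordinate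
only shifts the Gaussian factor, and a second application of Le Cam's third lemma gives the limits
under `P_{n,θ}`. Efficiency means `ν = ε_0`, which is equivalent to `ν ∗ N(θ, 1 / σ²)` being
`N(θ, 1 / σ²)` because Gaussian characteristic functions have no zeros.
-/

/-! ### Convergence in distribution -/

section Distribution

variable {ι E Ω' : Type*} {S : ι → Type*} [∀ i, MeasurableSpace (S i)]
  {μ : (i : ι) → Measure (S i)} [∀ i, IsProbabilityMeasure (μ i)]
  [MeasurableSpace Ω'] {μ' : Measure Ω'} [IsProbabilityMeasure μ']
  [TopologicalSpace E] [MeasurableSpace E] [OpensMeasurableSpace E]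
  {X : (i : ι) → S i → E} {Z : Ω' → E} {l : Filter ι}

lemma tendstoInDistribution_iff_integral (hX : ∀ i, AEMeasurable (X i) (μ i))
    (hZ : AEMeasurable Z μ') :
    TendstoInDistribution X l Z μ μ' ↔ ∀ f : BoundedContinuousFunction E ℝ,
      Tendsto (fun i => ∫ ω, f (X i ω) ∂μ i) l (𝓝 (∫ ω, f (Z ω) ∂μ')) := by
  have key : ∀ f : BoundedContinuousFunction E ℝ,
      Tendsto (fun i => ∫ x, f x ∂((μ i).map (X i))) l (𝓝 (∫ x, f x ∂(μ'.map Z))) ↔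
      Tendsto (fun i => ∫ ω, f (X i ω) ∂μ i) l (𝓝 (∫ ω, f (Z ω) ∂μ')) := by
    intro f
    rw [integral_map hZ f.continuous.measurable.aestronglyMeasurable]
    refine tendsto_congr fun i => ?_
    rw [integral_map (hX i) f.continuous.measurable.aestronglyMeasurable]
  constructor
  · intro h f
    exact (key f).1 (ProbabilityMeasure.tendsto_iff_forall_integral_tendsto.1 h.tendsto f)
  · intro h
    exact ⟨hX, hZ, ProbabilityMeasure.tendsto_iff_forall_integral_tendsto.2
      fun f => (key f).2 (h f)⟩

/-- Convergence in distribution to `Z` is convergence in distribution to the law of `Z`. -/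
lemma MeasureTheory.TendstoInDistribution.to_law (h : TendstoInDistribution X l Z μ μ')
    {m : Measure E} [IsProbabilityMeasure m] (hm : μ'.map Z = m) :
    TendstoInDistribution X l id μ m := by
  rw [tendstoInDistribution_iff_integral h.forall_aemeasurable aemeasurable_id]
  intro f
  have := (tendstoInDistribution_iff_integral h.forall_aemeasurable h.aemeasurable_limit).1 h f
  rwa [← integral_map h.aemeasurable_limit f.continuous.measurable.aestronglyMeasurable, hm] at this

lemma MeasureTheory.TendstoInDistribution.mono_filter {l' : Filter ι} (hl : l' ≤ l)
    (h : TendstoInDistribution X l Z μ μ') : TendstoInDistribution X l' Z μ μ' :=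
  ⟨h.forall_aemeasurable, h.aemeasurable_limit, h.tendsto.mono_left hl⟩

lemma MeasureTheory.TendstoInDistribution.congr_eventually {Y : (i : ι) → S i → E}
    (h : TendstoInDistribution X l Z μ μ') (hY : ∀ i, AEMeasurable (Y i) (μ i))
    (hXY : ∀ᶠ i in l, X i = Y i) : TendstoInDistribution Y l Z μ μ' := by
  rw [tendstoInDistribution_iff_integral hY h.aemeasurable_limit]
  intro f
  refine ((tendstoInDistribution_iff_integral h.forall_aemeasurable
    h.aemeasurable_limit).1 h f).congr' ?_
  filter_upwards [hXY] with i hi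
  rw [hi]

end Distribution

section Tightness

variable {S : ℕ → Type*} [∀ n, MeasurableSpace (S n)]
  {μ : (n : ℕ) → Measure (S n)} [∀ n, IsProbabilityMeasure (μ n)]
  {E F : Type*} [TopologicalSpace E] [PolishSpace E] [MeasurableSpace E] [BorelSpace E]
  [TopologicalSpace F] [PolishSpace F] [MeasurableSpace F] [BorelSpace F]

/-- The laws of a sequence converging in distribution form a tight set. -/
lemma MeasureTheory.TendstoInDistribution.isTightMeasureSet {X : (n : ℕ) → S n → E}
    {m : Measure E} [IsProbabilityMeasure m] (h : TendstoInDistribution X atTop id μ m) :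
    IsTightMeasureSet (Set.range fun n => (μ n).map (X n)) := by
  let := TopologicalSpace.upgradeIsCompletelyMetrizable E
  refine (isTightMeasureSet_of_isCompact_closure
    (h.tendsto.isCompact_insert_range.isClosed.closure_eq.symm ▸
      h.tendsto.isCompact_insert_range)).subset ?_
  rintro _ ⟨n, rfl⟩
  exact ⟨_, Set.mem_insert_of_mem _ ⟨n, rfl⟩, rfl⟩

/-- If both coordinates converge in distribution and all limit points of the joint laws agree,
then the joint laws converge. -/
lemma exists_tendstoInDistribution_prodMk {X : (n : ℕ) → S n → E} {Y : (n : ℕ) → S n → F}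
    (hX : ∀ n, Measurable (X n)) (hY : ∀ n, Measurable (Y n))
    {a : Measure E} [IsProbabilityMeasure a] {b : Measure F} [IsProbabilityMeasure b]
    (hXa : TendstoInDistribution X atTop id μ a) (hYb : TendstoInDistribution Y atTop id μ b)
    (huniq : ∀ (U V : Ultrafilter ℕ) (m m' : ProbabilityMeasure (E × F)),
      (U : Filter ℕ) ≤ atTop → (V : Filter ℕ) ≤ atTop →
      TendstoInDistribution (fun n ω => (X n ω, Y n ω)) U id μ (m : Measure (E × F)) →
      TendstoInDistribution (fun n ω => (X n ω, Y n ω)) V id μ (m' : Measure (E × F)) →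
      (m : Measure (E × F)) = m') :
    ∃ m : ProbabilityMeasure (E × F),
      TendstoInDistribution (fun n ω => (X n ω, Y n ω)) atTop id μ (m : Measure (E × F)) := by
  let := TopologicalSpace.upgradeIsCompletelyMetrizable E
  let := TopologicalSpace.upgradeIsCompletelyMetrizable F
  have hXY : ∀ n, Measurable fun ω => (X n ω, Y n ω) := fun n => (hX n).prodMk (hY n)
  let κ : ℕ → ProbabilityMeasure (E × F) := fun n =>
    ⟨(μ n).map fun ω => (X n ω, Y n ω), Measure.isProbabilityMeasure_map (hXY n).aemeasurable⟩
  have hκ : ∀ (U : Filter ℕ) (m : ProbabilityMeasure (E × F)), Tendsto κ U (𝓝 m) →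
      TendstoInDistribution (fun n ω => (X n ω, Y n ω)) U id μ (m : Measure (E × F)) :=
    fun U m h => ⟨fun n => (hXY n).aemeasurable, aemeasurable_id, by
      convert! h using 2
      simp only [Measure.map_id]
      rfl⟩
  have htight : IsTightMeasureSet (Set.range fun n => (κ n : Measure (E × F))) := by
    refine IsTightMeasureSet.prodMk ?_ ?_
    · rw [← Set.range_comp]
      convert! hXa.isTightMeasureSet using 2
      ext1 n
      exact Measure.map_map measurable_fst (hXY n)
    · rw [← Set.range_comp]
      convert! hYb.isTightMeasureSet using 2
      ext1 n
      exact Measure.map_map measurable_snd (hXY n)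
  have hcomp : IsCompact (closure (Set.range κ)) := by
    refine isCompact_closure_of_isTightMeasureSet (htight.subset ?_)
    rintro _ ⟨_, ⟨n, rfl⟩, rfl⟩
    exact ⟨n, rfl⟩
  have hmem : ∀ n, κ n ∈ closure (Set.range κ) := fun n => subset_closure ⟨n, rfl⟩
  obtain ⟨m, -, hm⟩ := hcomp.exists_mapClusterPt (u := κ) (f := atTop)
    (tendsto_principal.2 (Eventually.of_forall hmem))
  refine ⟨m, hκ _ _ (hcomp.tendsto_nhds_of_unique_mapClusterPt (Eventually.of_forall hmem)
    fun m' _ hm' => ?_)⟩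
  obtain ⟨U, hU, hUm⟩ := mapClusterPt_iff_ultrafilter.1 hm
  obtain ⟨V, hV, hVm⟩ := mapClusterPt_iff_ultrafilter.1 hm'
  exact Subtype.ext (huniq V U m' m hV hU (hκ _ _ hVm) (hκ _ _ hUm))

end Tightness

/-! ### Le Cam's third lemma -/

section LeCam

/-- If `log L` is within `ε` of the real number `h`, then `exp h ≤ exp ε * L`. -/
lemma ofReal_exp_le_of_abs_log_sub_lt {L : ℝ≥0∞} {h ε : ℝ}
    (hL : (ENNReal.log L - (h : EReal)).abs < ENNReal.ofReal ε) :
    ENNReal.ofReal (Real.exp h) ≤ ENNReal.ofReal (Real.exp ε) * L := by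
  induction L with
  | top => simp [ENNReal.mul_top, Real.exp_pos]
  | coe x =>
    rcases eq_or_ne x 0 with rfl | hx
    · simp at hL
    · have hx' : 0 < (x : ℝ) := by positivity
      rw [← ENNReal.ofReal_coe_nnreal, ENNReal.log_ofReal_of_pos hx', ← EReal.coe_sub,
        EReal.abs_def, ENNReal.ofReal_lt_ofReal_iff'] at hL
      rw [← ENNReal.ofReal_coe_nnreal, ← ENNReal.ofReal_mul (Real.exp_pos _).le]
      apply ENNReal.ofReal_le_ofReal
      rw [← Real.exp_log hx', ← Real.exp_add, Real.exp_le_exp]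
      have := (abs_lt.1 hL.1).1
      linarith

variable {ι E : Type*} {S : ι → Type*} [∀ i, MeasurableSpace (S i)]
  {μ ρ : (i : ι) → Measure (S i)} [∀ i, IsProbabilityMeasure (μ i)]
  [TopologicalSpace E] [MeasurableSpace E] [BorelSpace E]
  {W : (i : ι) → S i → E} {l : Filter ι} {m : Measure E} [IsProbabilityMeasure m]
  {h : E → ℝ}

/-- The one-sided half of Le Cam's third lemma. Truncating `exp h` at the level `K` makes it an
admissible test function for weak convergence, and outside a set of small `μ i`-probability the
truncation at `W i` is at most `exp ε` times the likelihood ratio. -/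
lemma eventually_lt_lintegral_of_log_rnDeriv (hW : ∀ i, Measurable (W i)) (hh : Continuous h)
    (hLR : ∀ ε : ℝ, 0 < ε → Tendsto (fun i => μ i {ω | ENNReal.ofReal ε ≤
      (ENNReal.log ((ρ i).rnDeriv (μ i) ω) - (h (W i ω) : EReal)).abs}) l (𝓝 0))
    (hm : TendstoInDistribution W l id μ m) (f : BoundedContinuousFunction E NNReal) {B : ℝ≥0∞}
    (hB : B < ∫⁻ x, f x ∂(m.withDensity fun x => ENNReal.ofReal (Real.exp (h x)))) :
    ∀ᶠ i in l, B < ∫⁻ ω, f (W i ω) ∂ρ i := by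
  have hB_top : B ≠ ∞ := hB.ne_top
  have hfm : Measurable fun x => (f x : ℝ≥0∞) := by fun_prop
  have hGm : Measurable fun x => ENNReal.ofReal (Real.exp (h x)) := by fun_prop
  -- the truncated test function
  let g : ℕ → E → NNReal := fun K x => min (Real.exp (h x)).toNNReal K * f x
  have hgcont : ∀ K, Continuous (g K) := fun K => by fun_prop
  obtain ⟨M, hM⟩ : ∃ M : NNReal, ∀ x, f x ≤ M := ⟨nndist 0 f, fun x => f.apply_le_nndist_zero x⟩
  have hgle : ∀ K x, g K x ≤ K * M := fun K x =>
    mul_le_mul (min_le_right _ _) (hM x) (by positivity) (by positivity)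
  obtain ⟨K, hK⟩ : ∃ K : ℕ, B < ∫⁻ x, g K x ∂m := by
    have hsup : ∫⁻ x, f x ∂(m.withDensity fun x => ENNReal.ofReal (Real.exp (h x))) =
        ⨆ K : ℕ, ∫⁻ x, g K x ∂m := by
      rw [lintegral_withDensity_eq_lintegral_mul _ hGm hfm, ← lintegral_iSup]
      · refine lintegral_congr fun x => le_antisymm ?_ ?_
        · obtain ⟨K, hK⟩ := exists_nat_ge (Real.exp (h x)).toNNReal
          refine le_iSup_of_le K ?_
          simp [g, min_eq_left hK, ENNReal.ofReal]
        · refine iSup_le fun K => ?_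
          simp only [g, Pi.mul_apply, ENNReal.coe_mul]
          gcongr
          exact ENNReal.coe_le_coe.2 (min_le_left _ _)
      · exact fun K => (hgcont K).measurable.coe_nnreal_ennreal
      · intro K K' hKK x
        simp only [g]
        gcongr
    rw [hsup] at hB
    exact lt_iSup_iff.1 hB
  obtain ⟨ε, hεB, hε⟩ : ∃ ε : ℝ, ENNReal.ofReal (Real.exp ε) * B < ∫⁻ x, g K x ∂m ∧ 0 < ε := by
    have ht : Tendsto (fun ε : ℝ => ENNReal.ofReal (Real.exp ε) * B) (𝓝[>] 0) (𝓝 (1 * B)) := by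
      refine ENNReal.Tendsto.mul_const ?_ (Or.inr hB_top)
      have : Continuous fun ε : ℝ => ENNReal.ofReal (Real.exp ε) :=
        ENNReal.continuous_ofReal.comp Real.continuous_exp
      simpa using (this.tendsto 0).mono_left nhdsWithin_le_nhds
    rw [one_mul] at ht
    exact ((ht.eventually_lt_const hK).and self_mem_nhdsWithin).exists
  let A : (i : ι) → Set (S i) := fun i => {ω | ENNReal.ofReal ε ≤
      (ENNReal.log ((ρ i).rnDeriv (μ i) ω) - (h (W i ω) : EReal)).abs}
  have hC : Tendsto (fun i => ∫⁻ ω, g K (W i ω) ∂μ i) l (𝓝 (∫⁻ x, g K x ∂m)) := by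
    let gb : BoundedContinuousFunction E NNReal :=
      BoundedContinuousFunction.mkOfBound ⟨g K, hgcont K⟩ (K * M) fun x y => by
        refine NNReal.dist_eq _ _ ▸ abs_sub_le_iff.2 ⟨?_, ?_⟩
        · have := NNReal.coe_le_coe.2 (hgle K x)
          have h0 := (g K y).coe_nonneg
          simp at this ⊢; linarith
        · have := NNReal.coe_le_coe.2 (hgle K y)
          have h0 := (g K x).coe_nonneg
          simp at this ⊢; linarith
    have := ProbabilityMeasure.tendsto_iff_forall_lintegral_tendsto.1 hm.tendsto gb
    simp only [ProbabilityMeasure.coe_mk, Measure.map_id] at this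
    refine this.congr fun i => ?_
    exact lintegral_map (hgcont K).measurable.coe_nnreal_ennreal (hW i)
  have hbound : ∀ i, ∫⁻ ω, g K (W i ω) ∂μ i ≤
      ENNReal.ofReal (Real.exp ε) * ∫⁻ ω, f (W i ω) ∂ρ i + (K * M : NNReal) * μ i (A i) := by
    intro i
    have hLm : Measurable ((ρ i).rnDeriv (μ i)) := Measure.measurable_rnDeriv _ _
    have hfW : Measurable fun ω => (f (W i ω) : ℝ≥0∞) := hfm.comp (hW i)
    calc ∫⁻ ω, g K (W i ω) ∂μ i
        ≤ ∫⁻ ω, (ENNReal.ofReal (Real.exp ε) * ((ρ i).rnDeriv (μ i) ω * f (W i ω)) +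
            (A i).indicator (fun _ => ((K * M : NNReal) : ℝ≥0∞)) ω) ∂μ i := by
          refine lintegral_mono fun ω => ?_
          by_cases hω : ω ∈ A i
          · rw [Set.indicator_of_mem hω]
            exact (ENNReal.coe_le_coe.2 (hgle K _)).trans le_add_self
          · rw [Set.indicator_of_notMem hω, add_zero, ← mul_assoc]
            simp only [g, ENNReal.coe_mul]
            gcongr
            refine le_trans (ENNReal.coe_le_coe.2 (min_le_left _ _)) ?_
            exact ofReal_exp_le_of_abs_log_sub_lt (not_le.1 hω)
      _ = ENNReal.ofReal (Real.exp ε) * ∫⁻ ω, (ρ i).rnDeriv (μ i) ω * f (W i ω) ∂μ i +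
            ∫⁻ ω, (A i).indicator (fun _ => ((K * M : NNReal) : ℝ≥0∞)) ω ∂μ i := by
          rw [lintegral_add_left (by fun_prop), lintegral_const_mul _ (by fun_prop)]
      _ ≤ _ := by
          refine add_le_add (mul_le_mul_right ?_ _) (lintegral_indicator_const_le _ _)
          have := lintegral_withDensity_eq_lintegral_mul (μ i) hLm hfW
          simp only [Pi.mul_apply] at this
          rw [← this]
          exact lintegral_mono' (Measure.withDensity_rnDeriv_le _ _) le_rfl
  have hx : Tendsto (fun i => ∫⁻ ω, g K (W i ω) ∂μ i - (K * M : NNReal) * μ i (A i)) l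
      (𝓝 (∫⁻ x, g K x ∂m)) := by
    have h0 : Tendsto (fun i => ((K * M : NNReal) : ℝ≥0∞) * μ i (A i)) l (𝓝 0) := by
      have := ENNReal.Tendsto.const_mul (a := ((K * M : NNReal) : ℝ≥0∞)) (hLR ε hε)
        (Or.inr ENNReal.coe_ne_top)
      rwa [mul_zero] at this
    simpa using ENNReal.Tendsto.sub hC h0 (Or.inr ENNReal.zero_ne_top)
  filter_upwards [hx.eventually_const_lt hεB] with i hi
  have := hi.trans_le (tsub_le_iff_right.2 (hbound i))
  exact lt_of_mul_lt_mul_left' this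

variable [∀ i, IsProbabilityMeasure (ρ i)]

/-- **Le Cam's third lemma**. If the law of `W i` under `μ i` converges weakly to `m` and the
log-likelihood ratio of `ρ i` with respect to `μ i` is `h (W i)` up to a term vanishing in
`μ i`-probability, then the law of `W i` under `ρ i` converges weakly to `exp h • m`, provided the
latter has mass one. Neither contiguity nor absolute continuity is assumed: mass one excludes
a loss of mass in the limit. -/
theorem tendstoInDistribution_of_log_rnDeriv (hW : ∀ i, Measurable (W i)) (hh : Continuous h)
    (hLR : ∀ ε : ℝ, 0 < ε → Tendsto (fun i => μ i {ω | ENNReal.ofReal ε ≤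
      (ENNReal.log ((ρ i).rnDeriv (μ i) ω) - (h (W i ω) : EReal)).abs}) l (𝓝 0))
    (hm : TendstoInDistribution W l id μ m)
    [IsProbabilityMeasure (m.withDensity fun x => ENNReal.ofReal (Real.exp (h x)))] :
    TendstoInDistribution W l id ρ
      (m.withDensity fun x => ENNReal.ofReal (Real.exp (h x))) := by
  set m' := m.withDensity fun x => ENNReal.ofReal (Real.exp (h x)) with hm'
  rw [tendstoInDistribution_iff_integral (fun i => (hW i).aemeasurable) aemeasurable_id]
  intro f
  rcases eq_or_neBot l with rfl | hl
  · simp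
  have : ∀ i, IsProbabilityMeasure ((ρ i).map (W i)) :=
    fun i => Measure.isProbabilityMeasure_map (hW i).aemeasurable
  have hmap : ∀ (g : BoundedContinuousFunction E ℝ) i,
      ∫ x, g x ∂((ρ i).map (W i)) = ∫ ω, g (W i ω) ∂ρ i := fun g i =>
    integral_map (hW i).aemeasurable g.continuous.measurable.aestronglyMeasurable
  simp_rw [← hmap]
  refine BoundedContinuousFunction.tendsto_integral_of_forall_integral_le_liminf_integral
    (fun g hg => ?_) f
  refine le_of_forall_lt fun B hB => ?_
  obtain ⟨B', hBB', hB'⟩ := exists_between hB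
  refine hBB'.trans_le ?_
  refine le_liminf_of_le ?_ ?_
  · exact (BddAbove.isBoundedUnder l.univ_mem
      (by simpa using (g.isBounded_range_integral
        (fun i => (ρ i).map (W i))).bddAbove)).isCoboundedUnder_ge
  · rcases lt_or_ge B' 0 with hneg | hpos
    · exact Eventually.of_forall fun i => hneg.le.trans (integral_nonneg hg)
    let f' : BoundedContinuousFunction E NNReal := g.comp _ Real.lipschitzWith_toNNReal
    have hint : ∀ (κ : Measure E) [IsProbabilityMeasure κ],
        ∫ x, g x ∂κ = (∫⁻ x, f' x ∂κ).toReal := fun κ _ =>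
      integral_eq_lintegral_of_nonneg_ae (Eventually.of_forall hg)
        g.continuous.measurable.aestronglyMeasurable
    have hfin : ∀ (κ : Measure E) [IsProbabilityMeasure κ], ∫⁻ x, f' x ∂κ ≠ ∞ := fun κ _ =>
      (f'.lintegral_lt_top_of_nnreal κ).ne
    have h1 : ENNReal.ofReal B' < ∫⁻ x, f' x ∂m' := by
      rw [hint m'] at hB'
      exact (ENNReal.ofReal_lt_iff_lt_toReal hpos (hfin m')).2 hB'
    filter_upwards [eventually_lt_lintegral_of_log_rnDeriv hW hh hLR hm f' h1] with i hi
    rw [hint]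
    refine ((ENNReal.ofReal_lt_iff_lt_toReal hpos (hfin _)).1 (hi.trans_eq ?_)).le
    exact (lintegral_map f'.continuous.measurable.coe_nnreal_ennreal (hW i)).symm

end LeCam

/-! ### Exponential tilting and analyticity -/

section Gaussian

/-- Exponential tilting shifts the mean of a Gaussian law. -/
lemma gaussianReal_withDensity_exp {v : NNReal} (hv : v ≠ 0) (θ : ℝ) :
    (gaussianReal 0 v).withDensity
      (fun x => ENNReal.ofReal (Real.exp (θ * x - θ ^ 2 * v / 2))) = gaussianReal (θ * v) v := by
  have hv' : (v : ℝ) ≠ 0 := by exact_mod_cast hv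
  rw [gaussianReal_of_var_ne_zero _ hv, gaussianReal_of_var_ne_zero _ hv,
    ← withDensity_mul _ (measurable_gaussianPDF _ _) (by fun_prop)]
  congr 1
  ext1 x
  simp only [Pi.mul_apply, gaussianPDF, gaussianPDFReal]
  rw [← ENNReal.ofReal_mul (by positivity), mul_assoc, ← Real.exp_add]
  congr 3
  field_simp
  ring

/-- The tilt of a joint law by its Gaussian first coordinate has mass one, so no mass is lost
in Le Cam's third lemma. -/
lemma isProbabilityMeasure_withDensity_exp_fst {m : Measure (ℝ × ℝ)} {v : NNReal} (hv : v ≠ 0)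
    (hm : m.fst = gaussianReal 0 v) (θ : ℝ) :
    IsProbabilityMeasure
      (m.withDensity fun p => ENNReal.ofReal (Real.exp (θ * p.1 - θ ^ 2 * v / 2))) := by
  constructor
  have h1 : (gaussianReal (θ * v) v) Set.univ = 1 := measure_univ
  rw [← gaussianReal_withDensity_exp hv, withDensity_apply _ MeasurableSet.univ,
    Measure.restrict_univ, ← hm, Measure.fst, lintegral_map (by fun_prop) measurable_fst] at h1
  rw [withDensity_apply _ MeasurableSet.univ, Measure.restrict_univ, h1]

end Gaussian

section Analytic

/-- A weighted complex moment generating function `z ↦ ∫ w e^{zY}` with bounded weight is entire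
if all exponential moments of `Y` are finite. -/
lemma differentiable_integral_mul_cexp {α : Type*} [MeasurableSpace α] {m : Measure α}
    {Y : α → ℝ} (hY : Measurable Y) {w : α → ℂ} (hw : Measurable w) (hw1 : ∀ a, ‖w a‖ ≤ 1)
    (hexp : ∀ r : ℝ, Integrable (fun a => Real.exp (r * Y a)) m) :
    Differentiable ℂ fun z : ℂ => ∫ a, w a * Complex.exp (z * Y a) ∂m := by
  intro z₀
  have hY' : Measurable fun a => (Y a : ℂ) := Complex.measurable_ofReal.comp hY
  have hnorm : ∀ (z : ℂ) a, ‖w a * Complex.exp (z * Y a)‖ ≤ Real.exp (z.re * Y a) := by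
    intro z a
    rw [norm_mul, Complex.norm_exp]
    simpa using mul_le_mul_of_nonneg_right (hw1 a) (Real.exp_pos (z.re * Y a)).le
  set R : ℝ := ‖z₀‖ + 2 with hR
  refine (hasDerivAt_integral_of_dominated_loc_of_deriv_le
    (F := fun z a => w a * Complex.exp (z * Y a))
    (F' := fun z a => w a * (Complex.exp (z * Y a) * Y a))
    (bound := fun a => Real.exp (R * Y a) + Real.exp (-R * Y a))
    (s := Metric.ball z₀ 1) (Metric.ball_mem_nhds _ one_pos)
    (Eventually.of_forall fun z => by fun_prop) ?_ (by fun_prop) ?_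
    ((hexp _).add (hexp _)) ?_).2.differentiableAt
  · exact (hexp z₀.re).mono' (by fun_prop) (Eventually.of_forall (hnorm z₀))
  · refine Eventually.of_forall fun a z hz => ?_
    have hre : |z.re| ≤ ‖z₀‖ + 1 := by
      refine (Complex.abs_re_le_norm z).trans ?_
      have : ‖z‖ ≤ ‖z₀‖ + ‖z - z₀‖ := by simpa using norm_add_le z₀ (z - z₀)
      have h1 : ‖z - z₀‖ < 1 := by simpa [dist_eq_norm] using hz
      linarith
    have h1 : ‖w a * (Complex.exp (z * Y a) * Y a)‖ ≤ Real.exp (z.re * Y a) * |Y a| := by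
      rw [← mul_assoc, norm_mul, Complex.norm_real, Real.norm_eq_abs]
      exact mul_le_mul_of_nonneg_right (hnorm z a) (abs_nonneg _)
    have h2 : Real.exp (z.re * Y a) * |Y a| ≤ Real.exp (R * |Y a|) := by
      have h3 : |Y a| ≤ Real.exp |Y a| := by linarith [Real.add_one_le_exp |Y a|]
      have h4 : z.re * Y a ≤ (‖z₀‖ + 1) * |Y a| := by
        refine (le_abs_self _).trans ?_
        rw [abs_mul]
        gcongr
      calc Real.exp (z.re * Y a) * |Y a|
          ≤ Real.exp ((‖z₀‖ + 1) * |Y a|) * Real.exp |Y a| := by gcongr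
        _ = Real.exp (R * |Y a|) := by rw [← Real.exp_add, hR]; ring_nf
    refine h1.trans (h2.trans ?_)
    rcases abs_cases (Y a) with ⟨h, _⟩ | ⟨h, _⟩
    · rw [h]; linarith [Real.exp_pos (-R * Y a)]
    · rw [h, mul_neg, ← neg_mul]; linarith [Real.exp_pos (R * Y a)]
  · refine Eventually.of_forall fun a z _ => ?_
    have := ((hasDerivAt_id z).mul_const (Y a : ℂ)).cexp.const_mul (w a)
    simpa using this

/-- Two entire functions that agree on a real set whose closure has nonempty interior are equal. -/
lemma Differentiable.eq_of_eqOn_ofReal {f g : ℂ → ℂ} (hf : Differentiable ℂ f)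
    (hg : Differentiable ℂ g) {Θ : Set ℝ} (hΘ : (interior (closure Θ)).Nonempty)
    (hfg : ∀ θ ∈ Θ, f θ = g θ) : f = g := by
  obtain ⟨θ₁, hθ₁⟩ := hΘ
  have hfreq : ∃ᶠ θ in 𝓝[≠] θ₁, θ ∈ Θ := by
    have hcl : closure Θ ∈ 𝓝 θ₁ := mem_interior_iff_mem_nhds.1 hθ₁
    rw [← mem_closure_ne_iff_frequently_within, mem_closure_iff]
    intro O hO hθO
    have hO' : IsOpen ((O ∩ interior (closure Θ)) \ {θ₁}) :=
      (hO.inter isOpen_interior).sdiff isClosed_singleton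
    have hne : ((O ∩ interior (closure Θ)) \ {θ₁}).Nonempty := by
      have : (O ∩ interior (closure Θ)) ∈ 𝓝 θ₁ := (hO.inter isOpen_interior).mem_nhds ⟨hθO, hθ₁⟩
      have h2 : (O ∩ interior (closure Θ)) \ {θ₁} ∈ 𝓝[≠] θ₁ :=
        inter_mem (mem_nhdsWithin_of_mem_nhds this) self_mem_nhdsWithin
      exact NeBot.nonempty_of_mem inferInstance h2
    obtain ⟨x, hx⟩ := hne
    obtain ⟨y, hy, hyΘ⟩ := mem_closure_iff.1 (interior_subset hx.1.2) _ hO' hx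
    exact ⟨y, hy.1.1, hyΘ, hy.2⟩
  have htend : Tendsto (fun θ : ℝ => (θ : ℂ)) (𝓝[≠] θ₁) (𝓝[≠] (θ₁ : ℂ)) := by
    refine tendsto_nhdsWithin_iff.2 ⟨(Complex.continuous_ofReal.tendsto θ₁).mono_left
      nhdsWithin_le_nhds, ?_⟩
    filter_upwards [self_mem_nhdsWithin] with θ hθ
    simpa using hθ
  exact AnalyticOnNhd.eq_of_frequently_eq (z₀ := (θ₁ : ℂ)) (fun z _ => hf.analyticAt z)
    (fun z _ => hg.analyticAt z) (htend.frequently (hfreq.mono hfg))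

end Analytic

/-! ### The limit experiment -/

section Limit

open Complex

variable {m : Measure (ℝ × ℝ)} {Q : Measure ℝ} {v : NNReal} {Θ : Set ℝ}

/-- Regularity on `Θ` determines the joint transform of the limit law: both sides are entire
in `z`, and for `z = θ ∈ Θ` the identity says that the characteristic function of the second
coordinate under the tilted measure is that of `Q ∗ ε_θ`. -/
lemma integral_cexp_of_regular [IsProbabilityMeasure Q] (hfst : m.fst = gaussianReal 0 v)
    (hΘ : (interior (closure Θ)).Nonempty)
    (hreg : ∀ θ ∈ Θ, (m.withDensity fun p =>
      ENNReal.ofReal (Real.exp (θ * p.1 - θ ^ 2 * v / 2))).snd =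
        Measure.conv Q (Measure.dirac θ)) (t : ℝ) (z : ℂ) :
    ∫ p, cexp (t * p.2 * I) * cexp (z * p.1) ∂m =
      cexp (z ^ 2 * v / 2 + t * z * I) * charFun Q t := by
  have hexp : ∀ r : ℝ, Integrable (fun p : ℝ × ℝ => Real.exp (r * p.1)) m := by
    intro r
    have := integrable_exp_mul_gaussianReal (μ := 0) (v := v) r
    rw [← hfst, Measure.fst] at this
    exact this.comp_measurable measurable_fst
  have hdiff := differentiable_integral_mul_cexp (m := m) (Y := Prod.fst) measurable_fst
    (w := fun p => cexp (t * p.2 * I)) (by fun_prop)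
    (fun p => by rw [← ofReal_mul, norm_exp_ofReal_mul_I]) hexp
  have hdiff' : Differentiable ℂ fun z : ℂ => cexp (z ^ 2 * v / 2 + t * z * I) * charFun Q t := by
    fun_prop
  refine congrFun (hdiff.eq_of_eqOn_ofReal hdiff' hΘ fun θ hθ => ?_) z
  have h1 := congrArg (fun κ => charFun κ t) (hreg θ hθ)
  simp only [charFun_conv, charFun_dirac] at h1
  rw [charFun_apply_real, Measure.snd, integral_map (by fun_prop) (by fun_prop),
    integral_withDensity_eq_integral_toReal_smul (by fun_prop) (by simp)] at h1
  have h2 : ∀ p : ℝ × ℝ, cexp (t * p.2 * I) * cexp (θ * p.1) = cexp (θ ^ 2 * v / 2) *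
      ((ENNReal.ofReal (Real.exp (θ * p.1 - θ ^ 2 * v / 2))).toReal • cexp (t * p.2 * I)) := by
    intro p
    rw [ENNReal.toReal_ofReal (Real.exp_pos _).le, real_smul, ofReal_exp, ← Complex.exp_add,
      ← Complex.exp_add, ← Complex.exp_add]
    congr 1
    push_cast
    ring
  simp_rw [h2, integral_const_mul, h1, Complex.exp_add]
  simp
  ring_nf

/-- The characteristic function of a law on `ℝ × ℝ` as its joint transform at imaginary `z`. -/
lemma charFunDual_prod_real (m : Measure (ℝ × ℝ)) (L : StrongDual ℝ (ℝ × ℝ)) :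
    charFunDual m L = ∫ p, cexp (L (0, 1) * p.2 * I) * cexp (L (1, 0) * I * p.1) ∂m := by
  rw [charFunDual_apply]
  refine integral_congr_ae (Eventually.of_forall fun p => ?_)
  have : L p = p.1 * L (1, 0) + p.2 * L (0, 1) := by
    rw [← smul_eq_mul, ← smul_eq_mul, ← map_smul, ← map_smul, ← map_add]
    simp
  simp only [this, ← Complex.exp_add]
  congr 1
  push_cast
  ring

lemma charFunDual_real (κ : Measure ℝ) (K : StrongDual ℝ ℝ) :
    charFunDual κ K = charFun κ (K 1) := by
  rw [charFunDual_apply, charFun_apply_real]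
  refine integral_congr_ae (Eventually.of_forall fun x => ?_)
  have : K x = x * K 1 := by rw [← smul_eq_mul, ← map_smul]; simp
  simp only [this]
  push_cast
  ring_nf

/-- The joint transform determines the limit law. -/
lemma eq_of_integral_cexp [IsProbabilityMeasure m] {m' : Measure (ℝ × ℝ)} [IsProbabilityMeasure m']
    (h : ∀ (t : ℝ) (z : ℂ), ∫ p, cexp (t * p.2 * I) * cexp (z * p.1) ∂m =
      ∫ p, cexp (t * p.2 * I) * cexp (z * p.1) ∂m') : m = m' := by
  refine Measure.ext_of_charFunDual (funext fun L => ?_)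
  rw [charFunDual_prod_real, charFunDual_prod_real, h]

/-- The law of the second coordinate after subtracting its linear part `x / v`. -/
noncomputable def residualLaw (m : Measure (ℝ × ℝ)) (v : NNReal) : Measure ℝ :=
  m.map fun p => p.2 - p.1 / v

instance [IsProbabilityMeasure m] : IsProbabilityMeasure (residualLaw m v) :=
  Measure.isProbabilityMeasure_map (by fun_prop)

/-- Evaluate the joint transform at `z = -i t / v`. -/
lemma charFun_residualLaw (hv : v ≠ 0)
    (h : ∀ (t : ℝ) (z : ℂ), ∫ p, cexp (t * p.2 * I) * cexp (z * p.1) ∂m =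
      cexp (z ^ 2 * v / 2 + t * z * I) * charFun Q t) (t : ℝ) :
    charFun (residualLaw m v) t = cexp (t ^ 2 / (2 * v)) * charFun Q t := by
  have hv' : (v : ℂ) ≠ 0 := by exact_mod_cast hv
  have h1 : charFun (residualLaw m v) t =
      ∫ p, cexp (t * p.2 * I) * cexp (-(t / v * I) * p.1) ∂m := by
    rw [charFun_apply_real, residualLaw, integral_map (by fun_prop) (by fun_prop)]
    refine integral_congr_ae (Eventually.of_forall fun p => ?_)
    simp only [← Complex.exp_add]
    congr 1
    push_cast
    ring
  rw [h1, h]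
  congr 2
  have hI : I ^ 2 = -1 := I_sq
  field_simp
  linear_combination (-(t : ℂ) ^ 2) * hI

/-- In the limit the residual is independent of the central variable: the joint transform at
`z = i (u - t / v)` factors as `exp (-u² v / 2)` times the characteristic function of the residual
at `t`. -/
lemma map_residual_eq_prod [IsProbabilityMeasure m] (hv : v ≠ 0)
    (h : ∀ (t : ℝ) (z : ℂ), ∫ p, cexp (t * p.2 * I) * cexp (z * p.1) ∂m =
      cexp (z ^ 2 * v / 2 + t * z * I) * charFun Q t) :
    m.map (fun p : ℝ × ℝ => (p.1, p.2 - p.1 / v)) = (gaussianReal 0 v).prod (residualLaw m v) := by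
  have hv' : (v : ℂ) ≠ 0 := by exact_mod_cast hv
  have : IsProbabilityMeasure (m.map fun p : ℝ × ℝ => (p.1, p.2 - p.1 / v)) :=
    Measure.isProbabilityMeasure_map (by fun_prop)
  refine charFunDual_eq_prod_iff.1 fun L => ?_
  have h1 : charFunDual (m.map fun p : ℝ × ℝ => (p.1, p.2 - p.1 / v)) L =
      ∫ p, cexp (L (0, 1) * p.2 * I) * cexp ((L (1, 0) - L (0, 1) / v) * I * p.1) ∂m := by
    rw [charFunDual_prod_real, integral_map (by fun_prop) (by fun_prop)]
    refine integral_congr_ae (Eventually.of_forall fun p => ?_)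
    simp only [← Complex.exp_add]
    congr 1
    push_cast
    ring
  rw [h1, h, charFunDual_real, charFunDual_real, charFun_residualLaw hv h, charFun_gaussianReal,
    ← mul_assoc (cexp _) (cexp _), ← Complex.exp_add]
  simp only [ContinuousLinearMap.comp_apply, ContinuousLinearMap.inl_apply,
    ContinuousLinearMap.inr_apply]
  congr 2
  have hI : I ^ 2 = -1 := I_sq
  generalize (L (1, 0) : ℝ) = u
  generalize (L (0, 1) : ℝ) = t
  push_cast
  field_simp
  linear_combination ((u * v - t) ^ 2 + 2 * t * (u * v - t) : ℂ) * hI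

/-- The convolution identity of the limit experiment: the Gaussian factor cancels
the `exp (t² / (2 v))` in the characteristic function of the residual. -/
lemma conv_dirac_eq_conv_gaussianReal [IsProbabilityMeasure m] [IsProbabilityMeasure Q] (hv : v ≠ 0)
    (h : ∀ (t : ℝ) (z : ℂ), ∫ p, cexp (t * p.2 * I) * cexp (z * p.1) ∂m =
      cexp (z ^ 2 * v / 2 + t * z * I) * charFun Q t) (θ : ℝ) {w : NNReal} (hw : (w : ℝ) = 1 / v) :
    Measure.conv Q (Measure.dirac θ) = Measure.conv (residualLaw m v) (gaussianReal θ w) := by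
  have hv' : (v : ℂ) ≠ 0 := by exact_mod_cast hv
  refine Measure.ext_of_charFun (funext fun t => ?_)
  have hw' : (w : ℂ) = 1 / v := by exact_mod_cast congrArg ((↑) : ℝ → ℂ) hw
  rw [charFun_conv, charFun_conv, charFun_residualLaw hv h, charFun_dirac, charFun_gaussianReal,
    mul_comm, mul_right_comm, ← Complex.exp_add, hw']
  congr 2
  simp
  field_simp
  ring

end Limit

/-! ### Limits in the local model -/

namespace LANModel

variable {Ω : Type*} [MeasurableSpace Ω] {P : ℝ → Measure Ω} [∀ t, IsProbabilityMeasure (P t)]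
  {θ₀ : ℝ} {Θ : Set ℝ} {σ : ℝ} {X T Y : (n : ℕ) → (Fin n → Ω) → ℝ}
  {Q : Measure ℝ} [IsProbabilityMeasure Q] {l : Filter ℕ} {m : Measure (ℝ × ℝ)}
  [IsProbabilityMeasure m]

/-- Under local asymptotic normality, a joint limit law with the central sequence under `P_{n,0}`
turns into its exponential tilt under `P_{n,θ}`. -/
lemma IsLAN.tendstoInDistribution_tilt (hLAN : IsLAN P θ₀ Θ σ X) (hl : l ≤ atTop)
    (hY : ∀ n, Measurable (Y n))
    (h : TendstoInDistribution (fun n ω => (X n ω, Y n ω)) l id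
      (fun n => localModel P θ₀ n 0) m) {θ : ℝ} (hθ : θ ∈ Θ)
    [IsProbabilityMeasure (m.withDensity fun p =>
      ENNReal.ofReal (Real.exp (θ * p.1 - θ ^ 2 * (σ ^ 2).toNNReal / 2)))] :
    TendstoInDistribution (fun n ω => (X n ω, Y n ω)) l id (fun n => localModel P θ₀ n θ)
      (m.withDensity fun p =>
        ENNReal.ofReal (Real.exp (θ * p.1 - θ ^ 2 * (σ ^ 2).toNNReal / 2))) := by
  refine tendstoInDistribution_of_log_rnDeriv
    (h := fun p : ℝ × ℝ => θ * p.1 - θ ^ 2 * (σ ^ 2).toNNReal / 2)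
    (fun n => (hLAN.measurable n).prodMk (hY n)) (by fun_prop) (fun ε hε => ?_) h
  simp only [Real.coe_toNNReal _ (sq_nonneg σ)]
  exact (hLAN.expansion θ hθ ε hε).mono_left hl

/-- Any joint limit law with the central sequence under `P_{n,0}` has a Gaussian first marginal. -/
lemma IsLAN.fst_eq_gaussianReal (hLAN : IsLAN P θ₀ Θ σ X) [l.NeBot] (hl : l ≤ atTop)
    (h : TendstoInDistribution (fun n ω => (X n ω, Y n ω)) l id
      (fun n => localModel P θ₀ n 0) m) :
    m.fst = gaussianReal 0 (σ ^ 2).toNNReal := by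
  have := tendstoInDistribution_unique X (h.continuous_comp continuous_fst)
    (hLAN.clt.mono_filter hl)
  simpa [Measure.fst] using this

lemma IsRegular.tendstoInDistribution_scaled (hT : IsRegular P θ₀ Θ T Q) {θ : ℝ} (hθ : θ ∈ Θ) :
    TendstoInDistribution (fun (n : ℕ) ω => √(n : ℝ) * (T n ω - θ₀)) atTop id
      (fun n => localModel P θ₀ n θ) (Measure.conv Q (Measure.dirac θ)) := by
  have h := ((hT.tendsto θ hθ).continuous_comp (continuous_add_const θ)).to_law
    (m := Measure.conv Q (Measure.dirac θ)) (by rw [Measure.conv_dirac]; rfl)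
  refine h.congr_eventually
    (fun n => (((hT.measurable n).sub_const θ₀).const_mul _).aemeasurable) ?_
  -- the two centrings agree only for `n ≠ 0`, as `√0 = 0`
  filter_upwards [eventually_gt_atTop 0] with n hn
  ext1 ω
  have : √(n : ℝ) ≠ 0 := by positivity
  simp only [Function.comp_apply]
  field_simp
  ring

/-- The joint transform of every limit point of the laws of `(X n, √n (T n - θ₀))`
under `P_{n,0}`. -/
lemma integral_cexp_of_tendstoInDistribution (hΘ : (interior (closure Θ)).Nonempty)
    (hLAN : IsLAN P θ₀ Θ σ X) (hT : IsRegular P θ₀ Θ T Q) [l.NeBot] (hl : l ≤ atTop)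
    (h : TendstoInDistribution (fun n ω => (X n ω, √(n : ℝ) * (T n ω - θ₀))) l id
      (fun n => localModel P θ₀ n 0) m) (t : ℝ) (z : ℂ) :
    ∫ p, Complex.exp (t * p.2 * Complex.I) * Complex.exp (z * p.1) ∂m =
      Complex.exp (z ^ 2 * (σ ^ 2).toNNReal / 2 + t * z * Complex.I) * charFun Q t := by
  have hv : (σ ^ 2).toNNReal ≠ 0 := by simpa using hLAN.sigma_pos.ne'
  have hfst := hLAN.fst_eq_gaussianReal hl h
  refine integral_cexp_of_regular hfst hΘ (fun θ hθ => ?_) t z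
  have := isProbabilityMeasure_withDensity_exp_fst hv hfst θ
  have h1 := hLAN.tendstoInDistribution_tilt hl
    (fun n => ((hT.measurable n).sub_const θ₀).const_mul _) h hθ
  have h2 := tendstoInDistribution_unique (fun (n : ℕ) ω => √(n : ℝ) * (T n ω - θ₀))
    (h1.continuous_comp continuous_snd) ((hT.tendstoInDistribution_scaled hθ).mono_filter hl)
  simpa [Measure.snd] using h2

/-- For real-valued statistics, convergence to zero in probability is convergence in law
to the point mass at zero. -/
lemma tendstoZeroInProb_iff_dirac {μ : (n : ℕ) → Measure (Fin n → Ω)}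
    [∀ n, IsProbabilityMeasure (μ n)] {ν : Measure ℝ} [IsProbabilityMeasure ν]
    (h : TendstoInDistribution Y atTop id μ ν) (hY : ∀ n, Measurable (Y n)) :
    TendstoZeroInProb μ (fun n ω => ((Y n ω : ℝ) : EReal)) ↔ ν = Measure.dirac 0 := by
  have hset : ∀ ε : ℝ, 0 < ε → ∀ n, {ω | ENNReal.ofReal ε ≤ ((Y n ω : ℝ) : EReal).abs} =
      Y n ⁻¹' {x | ε ≤ |x|} := by
    intro ε hε n
    ext ω
    simp [EReal.abs_def, ENNReal.ofReal_le_ofReal_iff]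
  constructor
  · intro h0
    have hnull : ∀ ε : ℝ, 0 < ε → ν {x | ε < |x|} = 0 := by
      intro ε hε
      have hop : IsOpen {x : ℝ | ε < |x|} := isOpen_lt continuous_const continuous_abs
      have h1 := ProbabilityMeasure.le_liminf_measure_open_of_tendsto h.tendsto hop
      simp only [ProbabilityMeasure.coe_mk, Measure.map_id] at h1
      refine le_antisymm (h1.trans ?_) zero_le
      rw [← (h0 ε hε).liminf_eq]
      refine liminf_le_liminf (Eventually.of_forall fun n => ?_)
      dsimp only
      rw [hset ε hε n, Measure.map_apply (hY n) hop.measurableSet]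
      exact measure_mono (Set.preimage_mono fun x (hx : ε < |x|) => hx.le)
    have hae : (id : ℝ → ℝ) =ᵐ[ν] fun _ => 0 := by
      have h2 : ∀ᵐ x ∂ν, ∀ k : ℕ, |x| ≤ 1 / ((k : ℝ) + 1) := by
        refine ae_all_iff.2 fun k => ?_
        have := hnull (1 / ((k : ℝ) + 1)) (by positivity)
        rw [ae_iff]
        simpa only [not_le] using this
      filter_upwards [h2] with x hx
      have : |x| ≤ 0 := ge_of_tendsto' tendsto_one_div_add_atTop_nhds_zero_nat hx
      simpa using this
    simpa using (Measure.map_congr hae : ν.map id = ν.map fun _ => (0 : ℝ))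
  · rintro rfl ε hε
    have hcl : IsClosed {x : ℝ | ε ≤ |x|} := isClosed_le continuous_const continuous_abs
    have h1 := ProbabilityMeasure.limsup_measure_closed_le_of_tendsto h.tendsto hcl
    simp only [ProbabilityMeasure.coe_mk, Measure.map_id] at h1
    rw [Measure.dirac_apply' _ hcl.measurableSet, Set.indicator_of_notMem (by simpa using hε)] at h1
    refine tendsto_of_le_liminf_of_limsup_le zero_le (le_trans (le_of_eq ?_) h1)
    congr 1
    ext1 n
    rw [hset ε hε n, Measure.map_apply (hY n) hcl.measurableSet]

end LANModel

/-- Convolution with a Gaussian law is injective at the point mass: the characteristic function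
of a Gaussian law has no zeros. -/
lemma conv_gaussianReal_eq_gaussianReal_iff {ν : Measure ℝ} [IsProbabilityMeasure ν] {θ : ℝ}
    {w : NNReal} :
    Measure.conv ν (gaussianReal θ w) = gaussianReal θ w ↔ ν = Measure.dirac 0 := by
  refine ⟨fun h => Measure.ext_of_charFun (funext fun t => ?_), fun h => by
    rw [h, Measure.dirac_zero_conv]⟩
  have h1 := congrArg (fun κ => charFun κ t) h
  simp only [charFun_conv] at h1
  have h2 : charFun (gaussianReal θ w) t ≠ 0 := by
    rw [charFun_gaussianReal]; exact Complex.exp_ne_zero _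
  rw [(mul_eq_right₀ h2).1 h1]
  simp [charFun_dirac]

/-! ### The convolution theorem -/

theorem mainTheorem2 {Ω : Type*} [MeasurableSpace Ω]
    (P : ℝ → Measure Ω) [∀ t, IsProbabilityMeasure (P t)]
    (θ₀ : ℝ) (Θ : Set ℝ) (hΘ : (interior (closure Θ)).Nonempty)
    (σ : ℝ) (X : (n : ℕ) → (Fin n → Ω) → ℝ) (hLAN : LANModel.IsLAN P θ₀ Θ σ X)
    (T : (n : ℕ) → (Fin n → Ω) → ℝ) (Q : Measure ℝ) [IsProbabilityMeasure Q]
    (hT : LANModel.IsRegular P θ₀ Θ T Q) :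
    ∃ ν : ProbabilityMeasure ℝ,
      -- the remainder converges in law to `ν` under `θ = 0`, and to the same `ν` under `θ ∈ Θ`
      TendstoInDistribution (LANModel.remainder θ₀ σ X T) atTop id
        (fun n => LANModel.localModel P θ₀ n 0) (ν : Measure ℝ) ∧
      (∀ θ ∈ Θ, TendstoInDistribution (LANModel.remainder θ₀ σ X T) atTop id
        (fun n => LANModel.localModel P θ₀ n θ) (ν : Measure ℝ)) ∧
      -- joint convergence to a pair of independent variables with law `N(θσ², σ²) ⊗ ν`
      (∀ θ ∈ Θ, TendstoInDistribution
        (fun n ω => (X n ω, LANModel.remainder θ₀ σ X T n ω)) atTop id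
        (fun n => LANModel.localModel P θ₀ n θ)
        ((gaussianReal (θ * σ ^ 2) (σ ^ 2).toNNReal).prod (ν : Measure ℝ))) ∧
      -- `Q ∗ ε_θ` is the weak limit of `√n (T n - θ₀)`, and the convolution theorem holds
      (∀ θ ∈ Θ,
        TendstoInDistribution (fun (n : ℕ) ω => √(n : ℝ) * (T n ω - θ₀)) atTop id
          (fun n => LANModel.localModel P θ₀ n θ) (Measure.conv Q (Measure.dirac θ)) ∧
        Measure.conv Q (Measure.dirac θ) =
          Measure.conv (ν : Measure ℝ) (gaussianReal θ (1 / σ ^ 2).toNNReal)) ∧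
      -- characterization of asymptotic efficiency
      (LANModel.IsAsympEfficient P θ₀ σ X T ↔
        ∃ θ ∈ Θ, Measure.conv Q (Measure.dirac θ) = gaussianReal θ (1 / σ ^ 2).toNNReal) := by
  have hv : (σ ^ 2).toNNReal ≠ 0 := by simpa using hLAN.sigma_pos.ne'
  have hvσ : (((σ ^ 2).toNNReal : NNReal) : ℝ) = σ ^ 2 := Real.coe_toNNReal _ (sq_nonneg σ)
  have hS : ∀ n : ℕ, Measurable fun ω : Fin n → Ω => √(n : ℝ) * (T n ω - θ₀) :=
    fun n => ((hT.measurable n).sub_const θ₀).const_mul _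
  have hR : ∀ n, Measurable (LANModel.remainder θ₀ σ X T n) :=
    fun n => (hS n).sub ((hLAN.measurable n).div_const _)
  -- the joint laws under `P_{n,0}` converge, since all their limit points have the same transform
  obtain ⟨m, hm⟩ := exists_tendstoInDistribution_prodMk hLAN.measurable hS hLAN.clt
    (hT.tendstoInDistribution_scaled hLAN.zero_mem) fun U V m m' hU hV h h' =>
      eq_of_integral_cexp fun t z => by
        rw [LANModel.integral_cexp_of_tendstoInDistribution hΘ hLAN hT hU h,
          LANModel.integral_cexp_of_tendstoInDistribution hΘ hLAN hT hV h']
  have htransf := LANModel.integral_cexp_of_tendstoInDistribution hΘ hLAN hT le_rfl hm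
  let ν : Measure ℝ := residualLaw (m : Measure (ℝ × ℝ)) (σ ^ 2).toNNReal
  have hjoint0 : TendstoInDistribution (fun n ω => (X n ω, LANModel.remainder θ₀ σ X T n ω))
      atTop id (fun n => LANModel.localModel P θ₀ n 0)
      ((gaussianReal 0 (σ ^ 2).toNNReal).prod ν) := by
    have h1 : Continuous fun p : ℝ × ℝ => (p.1, p.2 - p.1 / (σ ^ 2).toNNReal) := by fun_prop
    have h2 := (hm.continuous_comp h1).to_law (map_residual_eq_prod hv htransf)
    simp only [hvσ] at h2
    exact h2
  -- tilting affects only the first factor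
  have hprod : ∀ θ : ℝ, ((gaussianReal 0 (σ ^ 2).toNNReal).prod ν).withDensity (fun p =>
      ENNReal.ofReal (Real.exp (θ * p.1 - θ ^ 2 * (σ ^ 2).toNNReal / 2))) =
      (gaussianReal (θ * σ ^ 2) (σ ^ 2).toNNReal).prod ν := by
    intro θ
    have h1 := gaussianReal_withDensity_exp hv θ
    rw [hvσ] at h1
    rw [← h1, prod_withDensity_left (by fun_prop), hvσ]
  have hjoint : ∀ θ ∈ Θ, TendstoInDistribution
      (fun n ω => (X n ω, LANModel.remainder θ₀ σ X T n ω)) atTop id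
      (fun n => LANModel.localModel P θ₀ n θ)
      ((gaussianReal (θ * σ ^ 2) (σ ^ 2).toNNReal).prod ν) := by
    intro θ hθ
    have hinst : IsProbabilityMeasure (((gaussianReal 0 (σ ^ 2).toNNReal).prod ν).withDensity
        fun p => ENNReal.ofReal (Real.exp (θ * p.1 - θ ^ 2 * (σ ^ 2).toNNReal / 2))) := by
      rw [hprod]; infer_instance
    have h1 := hLAN.tendstoInDistribution_tilt le_rfl hR hjoint0 hθ
    exact h1.to_law (by rw [Measure.map_id, hprod])
  have hrem : ∀ θ ∈ Θ, TendstoInDistribution (LANModel.remainder θ₀ σ X T) atTop id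
      (fun n => LANModel.localModel P θ₀ n θ) ν := fun θ hθ =>
    ((hjoint θ hθ).continuous_comp continuous_snd).to_law
      (by simp)
  have hconv : ∀ θ : ℝ, Measure.conv Q (Measure.dirac θ) =
      Measure.conv ν (gaussianReal θ (1 / σ ^ 2).toNNReal) := fun θ =>
    conv_dirac_eq_conv_gaussianReal hv htransf θ
      (by rw [hvσ, Real.coe_toNNReal _ (by positivity)])
  refine ⟨⟨ν, inferInstance⟩, hrem 0 hLAN.zero_mem, hrem, hjoint,
    fun θ hθ => ⟨hT.tendstoInDistribution_scaled hθ, hconv θ⟩, ?_⟩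
  simp only [hconv, conv_gaussianReal_eq_gaussianReal_iff]
  exact (LANModel.tendstoZeroInProb_iff_dirac (hrem 0 hLAN.zero_mem) hR).trans
    ⟨fun h => ⟨0, hLAN.zero_mem, h⟩, fun ⟨_, _, h⟩ => h⟩
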